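/- Let $n\ge 2$ be a fixed integer, and let $p=p(m)$, $m\in\mathbb N$, be positive integers for all large $m$, with $p\to\infty$ and $m/p\to c\in(0,\infty)$ as $m\to\infty$. For every $m$ let $\mathbf A_m$ be a deterministic real $m\times p$ matrix with non-negative entries such that $\frac1{mp}\operatorname{tr}(\mathbf A_m\mathbf A_m^\top)$ is bounded uniformly in $m$, and let $\boldsymbol\Sigma_m$ be a symmetric positive definite $m\times m$ matrix, with positive definite symmetric square root $\boldsymbol\Sigma_m^{1/2}$, such that $\frac1m\operatorname{tr}(\boldsymbol\Sigma_m)$ is bounded uniformly in $m$. On a common probability space let $\mathbf E_m^1,\dots,\mathbf E_m^n$ be random $m\times p$ matrices such that, for each $m$, all their $nmp$ entries are independent, the entries of each $\mathbf E_m^k$ are identically distributed, and the entries have mean zero, variance one, and absolute moments of order $4+\varepsilon$ bounded uniformly in $m$, for some $\varepsilon>0$ (no assumption is made on the joint law for different $m$). Put $$\tilde{\mathbf A}_m^k=\mathbf A_m+\boldsymbol\Sigma_m^{1/2}\mathbf E_m^k\quad(k=1,\dots,n),\qquad \bar{\mathbf A}_m=\frac1n\sum_{k=1}^n\tilde{\mathbf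 A}_m^k,$$ and let $\mathbf U_m$ be the $m\times p$ matrix with all entries equal to one. Then, as $m\to\infty$, $$\left|\frac1{(n-1)mp}\sum_{k=1}^n\operatorname{tr}\left((\tilde{\mathbf A}_m^k-\bar{\mathbf A}_m)(\tilde{\mathbf A}_m^k-\bar{\mathbf A}_m)^\top\right)-\frac1m\operatorname{tr}(\boldsymbol\Sigma_m)\right|\xrightarrow{a.s.}0 .$$ Moreover, define the data-driven shrinkage intensities $$\hat\alpha^*=1-\frac{\frac1{n(n-1)mp}\sum_{k=1}^n\operatorname{tr}\left((\tilde{\mathbf A}_m^k-\bar{\mathbf A}_m)(\tilde{\mathbf A}_m^k-\bar{\mathbf A}_m)^\top\right)}{\frac{\operatorname{tr}(\bar{\mathbf A}_m\bar{\mathbf A}_m^\top)}{mp}-\frac{\operatorname{tr}^2(\bar{\mathbf A}_m\mathbf U_m^\top)}{(mp)^2}},\qquad \hat\beta^*=(1-\hat\alpha^*)\frac{\operatorname{tr}(\bar{\mathbf A}_m\mathbf U_m^\top)}{mp},$$ and the asymptotic oracle intensities $$\alpha^*(\boldsymbol\Sigma_m)=\frac{\frac{\operatorname{tr}(\mathbf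 A_m\mathbf A_m^\top)}{mp}-\frac{\operatorname{tr}^2(\mathbf A_m\mathbf U_m^\top)}{(mp)^2}}{\frac{\operatorname{tr}(\mathbf A_m\mathbf A_m^\top)}{mp}+\frac{\operatorname{tr}(\boldsymbol\Sigma_m)}{nm}-\frac{\operatorname{tr}^2(\mathbf A_m\mathbf U_m^\top)}{(mp)^2}},\qquad \beta^*(\boldsymbol\Sigma_m)=(1-\alpha^*(\boldsymbol\Sigma_m))\frac{\operatorname{tr}(\mathbf A_m\mathbf U_m^\top)}{mp}.$$ Then almost surely the denominator of $\hat\alpha^*$ is nonzero for all large $m$, and $\hat\alpha^*$, $\hat\beta^*$ are strongly consistent: $$|\hat\alpha^*-\alpha^*(\boldsymbol\Sigma_m)|\xrightarrow{a.s.}0,\qquad |\hat\beta^*-\beta^*(\boldsymbol\Sigma_m)|\xrightarrow{a.s.}0 .$$ -/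

import Mathlib

open MeasureTheory ProbabilityTheory Filter Topology
open scoped MatrixOrder

noncomputable section

namespace Shrinkage

/-- The `m × p` target matrix all of whose entries are one. -/
def onesMatrix (m p : ℕ) : Matrix (Fin m) (Fin p) ℝ := Matrix.of fun _ _ => 1

/-- The observation `A + Σ^{1/2} E`, where `Σ^{1/2}` is the symmetric (positive semidefinite)
square root of `Σ`. -/
def observation {m p : ℕ} (A : Matrix (Fin m) (Fin p) ℝ) (S : Matrix (Fin m) (Fin m) ℝ)
    (E : Matrix (Fin m) (Fin p) ℝ) : Matrix (Fin m) (Fin p) ℝ :=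
  A + CFC.sqrt S * E

/-- The sample average of `n` observed matrices. -/
def sampleMean {n m p : ℕ} (X : Fin n → Matrix (Fin m) (Fin p) ℝ) :
    Matrix (Fin m) (Fin p) ℝ :=
  (1 / (n : ℝ)) • ∑ k, X k

/-- `(1 / (mp)) tr (X Yᵀ)`. -/
def normTrace {m p : ℕ} (X Y : Matrix (Fin m) (Fin p) ℝ) : ℝ :=
  1 / ((m : ℝ) * (p : ℝ)) * (X * Y.transpose).trace

/-- The pooled estimator `(1 / ((n - 1) m p)) ∑ₖ tr ((Xᵏ - X̄) (Xᵏ - X̄)ᵀ)`. -/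
def pooledEstimator {n m p : ℕ} (X : Fin n → Matrix (Fin m) (Fin p) ℝ) : ℝ :=
  1 / (((n : ℝ) - 1) * (m : ℝ) * (p : ℝ)) *
    ∑ k, ((X k - sampleMean X) * (X k - sampleMean X).transpose).trace

/-- The denominator `tr (X̄ X̄ᵀ) / (mp) - tr² (X̄ Uᵀ) / (mp)²` of the data-driven shrinkage
intensity. -/
def hatDenominator {n m p : ℕ} (X : Fin n → Matrix (Fin m) (Fin p) ℝ) : ℝ :=
  normTrace (sampleMean X) (sampleMean X) - normTrace (sampleMean X) (onesMatrix m p) ^ 2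

/-- The data-driven shrinkage intensity `α̂*`. -/
def alphaHat {n m p : ℕ} (X : Fin n → Matrix (Fin m) (Fin p) ℝ) : ℝ :=
  1 - (1 / ((n : ℝ) * ((n : ℝ) - 1) * (m : ℝ) * (p : ℝ)) *
    ∑ k, ((X k - sampleMean X) * (X k - sampleMean X).transpose).trace) / hatDenominator X

/-- The data-driven shrinkage intensity `β̂*`. -/
def betaHat {n m p : ℕ} (X : Fin n → Matrix (Fin m) (Fin p) ℝ) : ℝ :=
  (1 - alphaHat X) * normTrace (sampleMean X) (onesMatrix m p)

/-- The asymptotic oracle intensity `α*(Σ)`. -/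
def alphaOracle (n : ℕ) {m p : ℕ} (A : Matrix (Fin m) (Fin p) ℝ)
    (S : Matrix (Fin m) (Fin m) ℝ) : ℝ :=
  (normTrace A A - normTrace A (onesMatrix m p) ^ 2) /
    (normTrace A A + S.trace / ((n : ℝ) * (m : ℝ)) - normTrace A (onesMatrix m p) ^ 2)

/-- The asymptotic oracle intensity `β*(Σ)`. -/
def betaOracle (n : ℕ) {m p : ℕ} (A : Matrix (Fin m) (Fin p) ℝ)
    (S : Matrix (Fin m) (Fin m) ℝ) : ℝ :=
  (1 - alphaOracle n A S) * normTrace A (onesMatrix m p)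

end Shrinkage

end

/-
Let `v` be the size of the centered signal and `t = tr Σ / m` the noise level. The denominator of
`α̂*` is asymptotic to `v + t / n ≥ t / n`, and `n⁻¹` times the pooled estimator to `t / n`, both up
to errors that are `o(v + t / n)`; hence the ratios are consistent even when `v` and `t` tend to
zero. The errors are normalized traces that are linear or quadratic in independent centered
variables. A second-order Taylor bound for `x ↦ |x|^r`, `r ≥ 2`, shows that the squared `L^r` norm
of a sum of such variables is at most a constant times the sum of the squared norms. So the entries
of `Σ^{1/2} E` have `L^{4+ε}` norm controlled by the rows of `Σ^{1/2}`, and the `p` independent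
columns make the traces small of relative order `p^{-1/2}` in `L^r` for some `r > 2`. By Markov's
inequality and Borel–Cantelli, moments of order `r > 2` at rate `m^{-1/2}` suffice for almost sure
convergence along `m`, whatever the joint law for different `m`.
-/

namespace Shrinkage

section PowerInequalities

variable {a b q r : ℝ}

theorem rpow_add_tangent_le_rpow (hq : 1 ≤ q) (ha : 0 ≤ a) (hb : 0 ≤ b) :
    a ^ q + q * a ^ (q - 1) * (b - a) ≤ b ^ q := by
  rcases ha.eq_or_lt with rfl | ha
  · rcases hq.eq_or_lt with rfl | hq
    · simp
    · rw [Real.zero_rpow (by linarith), Real.zero_rpow (by linarith)]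
      simpa using Real.rpow_nonneg hb q
  · have bernoulli : 1 + q * (b / a - 1) ≤ (b / a) ^ q := by
      simpa using one_add_mul_self_le_rpow_one_add
        (show -1 ≤ b / a - 1 by linarith [div_nonneg hb ha.le]) hq
    rw [Real.div_rpow hb ha.le, le_div_iff₀ (Real.rpow_pos_of_pos ha q)] at bernoulli
    rw [Real.rpow_sub_one ha.ne']
    calc a ^ q + q * (a ^ q / a) * (b - a) = (1 + q * (b / a - 1)) * a ^ q := by field_simp
      _ ≤ b ^ q := bernoulli

theorem mul_add_rpow_sub_rpow_le {s x : ℝ} (hq : 1 ≤ q) (hs : 0 ≤ s) (hsx : 0 ≤ s + x) :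
    x * ((s + x) ^ q - s ^ q) ≤ q * x ^ 2 * (s + |x|) ^ (q - 1) := by
  rcases le_total 0 x with hx | hx
  · have tangent := rpow_add_tangent_le_rpow hq hsx hs
    rw [abs_of_nonneg hx]
    nlinarith
  · have tangent := rpow_add_tangent_le_rpow hq hs hsx
    have mono : s ^ (q - 1) ≤ (s + |x|) ^ (q - 1) :=
      Real.rpow_le_rpow hs (by linarith [abs_nonneg x]) (by linarith)
    calc x * ((s + x) ^ q - s ^ q) ≤ x * (q * s ^ (q - 1) * x) :=
          mul_le_mul_of_nonpos_left (by linarith) hx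
      _ = q * x ^ 2 * s ^ (q - 1) := by ring
      _ ≤ q * x ^ 2 * (s + |x|) ^ (q - 1) := by gcongr

theorem add_rpow_le_two_rpow_mul_add (hq : 0 ≤ q) (ha : 0 ≤ a) (hb : 0 ≤ b) :
    (a + b) ^ q ≤ 2 ^ q * (a ^ q + b ^ q) := by
  calc (a + b) ^ q ≤ (2 * max a b) ^ q := by
        gcongr
        linarith [le_max_left a b, le_max_right a b]
    _ = 2 ^ q * max a b ^ q := Real.mul_rpow two_pos.le (ha.trans (le_max_left a b))
    _ ≤ 2 ^ q * (a ^ q + b ^ q) := by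
        gcongr
        rcases max_choice a b with h | h <;> rw [h] <;>
          linarith [Real.rpow_nonneg ha q, Real.rpow_nonneg hb q]

theorem rpow_sub_two_mul_sq (hr : r ≠ 0) (ha : 0 ≤ a) : a ^ (r - 2) * a ^ 2 = a ^ r := by
  rw [← Real.rpow_two, ← Real.rpow_add' ha (by simpa using hr), sub_add_cancel]

/-- The constant of the second-order Taylor bound `abs_add_rpow_le` for `|·| ^ r`. -/
noncomputable def taylorConst (r : ℝ) : ℝ := r ^ 2 * 2 ^ r

theorem le_taylorConst (hr : 1 ≤ r) : r ≤ taylorConst r := by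
  have h : (1 : ℝ) ≤ 2 ^ r := Real.one_le_rpow one_le_two (by linarith)
  unfold taylorConst
  nlinarith

theorem taylorConst_nonneg (r : ℝ) : 0 ≤ taylorConst r := by
  unfold taylorConst
  positivity

theorem add_rpow_le_of_nonneg {s x : ℝ} (hr : 2 ≤ r) (hs : 0 ≤ s) (hsx : 0 ≤ s + x) :
    (s + x) ^ r ≤ s ^ r + r * s ^ (r - 1) * x +
      taylorConst r * (s ^ (r - 2) * x ^ 2 + |x| ^ r) := by
  have tangent := rpow_add_tangent_le_rpow (show 1 ≤ r by linarith) hsx hs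
  have remainder : x * ((s + x) ^ (r - 1) - s ^ (r - 1)) ≤
      (r - 1) * x ^ 2 * (2 ^ (r - 2) * (s ^ (r - 2) + |x| ^ (r - 2))) := by
    refine (mul_add_rpow_sub_rpow_le (by linarith) hs hsx).trans ?_
    rw [show r - 1 - 1 = r - 2 by ring]
    have h := add_rpow_le_two_rpow_mul_add (show 0 ≤ r - 2 by linarith) hs (abs_nonneg x)
    have : 0 ≤ r - 1 := by linarith
    gcongr
  have const_le : r * ((r - 1) * 2 ^ (r - 2)) ≤ taylorConst r := by
    have : (2 : ℝ) ^ (r - 2) ≤ 2 ^ r := Real.rpow_le_rpow_of_exponent_le one_le_two (by linarith)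
    rw [taylorConst, pow_two, mul_assoc]
    gcongr
    linarith
  have hx : |x| ^ (r - 2) * x ^ 2 = |x| ^ r := by
    rw [← sq_abs, rpow_sub_two_mul_sq (by linarith) (abs_nonneg x)]
  calc (s + x) ^ r ≤ s ^ r + r * s ^ (r - 1) * x +
        r * (x * ((s + x) ^ (r - 1) - s ^ (r - 1))) := by linarith
    _ ≤ s ^ r + r * s ^ (r - 1) * x +
        r * ((r - 1) * x ^ 2 * (2 ^ (r - 2) * (s ^ (r - 2) + |x| ^ (r - 2)))) := by gcongr
    _ = s ^ r + r * s ^ (r - 1) * x +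
        r * ((r - 1) * 2 ^ (r - 2)) * (s ^ (r - 2) * x ^ 2 + |x| ^ r) := by rw [← hx]; ring
    _ ≤ _ := by gcongr

theorem abs_add_rpow_le (hr : 2 ≤ r) (s x : ℝ) :
    |s + x| ^ r ≤ |s| ^ r + r * (|s| ^ (r - 2) * s * x) +
      taylorConst r * (|s| ^ (r - 2) * x ^ 2 + |x| ^ r) := by
  wlog hs : 0 ≤ s generalizing s x
  · have h := this (-s) (-x) (by linarith)
    rw [← neg_add] at h
    simpa only [abs_neg, neg_sq, mul_neg, neg_mul, neg_neg] using h
  rw [abs_of_nonneg hs]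
  have hC := le_taylorConst (show 1 ≤ r by linarith)
  have h_rpow : s ^ (r - 2) * s = s ^ (r - 1) := by
    rw [← Real.rpow_add_one' hs (by linarith)]
    ring_nf
  rcases le_or_gt 0 (s + x) with hsx | hsx
  · rw [abs_of_nonneg hsx, h_rpow, ← mul_assoc]
    exact add_rpow_le_of_nonneg hr hs hsx
  · have h_rpow_le : |s + x| ^ r ≤ |x| ^ r := by
      refine Real.rpow_le_rpow (abs_nonneg _) ?_ (by linarith)
      rw [abs_of_neg hsx, abs_of_neg (by linarith)]
      linarith
    have h_middle_nonneg :
        0 ≤ r * (s ^ (r - 2) * s * x) + taylorConst r * (s ^ (r - 2) * x ^ 2) := by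
      have : 0 ≤ s ^ (r - 2) * (-x) * (taylorConst r * (-x) - r * s) :=
        mul_nonneg (mul_nonneg (by positivity) (by linarith)) (by nlinarith)
      linarith
    have h_le_remainder : |x| ^ r ≤ taylorConst r * |x| ^ r :=
      le_mul_of_one_le_left (by positivity) (by linarith)
    linarith [Real.rpow_nonneg hs r]

theorem rpow_add_mul_le_add_sq_rpow {C : ℝ} (hr : 2 ≤ r) (hC : 1 ≤ C) (ha : 0 ≤ a) (hb : 0 ≤ b) :
    a ^ r + C * (a ^ (r - 2) * b ^ 2 + b ^ r) ≤ (a ^ 2 + 2 * C * b ^ 2) ^ (r / 2) := by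
  have sq_rpow : ∀ {x : ℝ} (t : ℝ), 0 ≤ x → (x ^ 2) ^ (t / 2) = x ^ t := fun t hx => by
    rw [← Real.rpow_two, ← Real.rpow_mul hx, mul_div_cancel₀ _ two_ne_zero]
  have tangent := rpow_add_tangent_le_rpow (show 1 ≤ r / 2 by linarith) (sq_nonneg a)
    (show 0 ≤ a ^ 2 + 2 * C * b ^ 2 by positivity)
  rw [show r / 2 - 1 = (r - 2) / 2 by ring, sq_rpow _ ha, sq_rpow _ ha] at tangent
  have superadditive := Real.add_rpow_le_rpow_add (sq_nonneg a)
    (show 0 ≤ 2 * C * b ^ 2 by positivity) (show 1 ≤ r / 2 by linarith)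
  rw [Real.mul_rpow (by positivity) (sq_nonneg b), sq_rpow _ ha, sq_rpow _ hb] at superadditive
  have h_const_rpow : 2 * C * b ^ r ≤ (2 * C) ^ (r / 2) * b ^ r := by
    gcongr
    exact Real.self_le_rpow_of_one_le (by linarith) (by linarith)
  have h_const_mul : 2 * (C * (a ^ (r - 2) * b ^ 2)) ≤ r * (C * (a ^ (r - 2) * b ^ 2)) := by gcongr
  linarith

end PowerInequalities

open scoped NNReal ENNReal

section LpNorm

variable {Ω : Type*} [MeasurableSpace Ω] {μ : Measure Ω} {f g : Ω → ℝ} {q r : ℝ≥0}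

theorem lpNorm_rpow_eq_integral (hr : r ≠ 0) (hf : AEStronglyMeasurable f μ) :
    lpNorm f r μ ^ (r : ℝ) = ∫ ω, |f ω| ^ (r : ℝ) ∂μ := by
  rw [lpNorm_nnreal_eq_integral_norm_rpow hr hf, Real.rpow_inv_rpow (by positivity) (by simpa)]
  rfl

theorem lpNorm_mul_le {s t u : ℝ≥0∞} [ENNReal.HolderTriple s t u] (hf : MemLp f s μ)
    (hg : MemLp g t μ) : lpNorm (f * g) u μ ≤ lpNorm f s μ * lpNorm g t μ := by
  have holder : eLpNorm (f * g) u μ ≤ eLpNorm f s μ * eLpNorm g t μ :=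
    eLpNorm_smul_le_mul_eLpNorm (φ := f) (f := g) hg.1 hf.1
  rw [← toReal_eLpNorm hf.1, ← toReal_eLpNorm hg.1, ← toReal_eLpNorm (hf.1.mul hg.1),
    ← ENNReal.toReal_mul]
  exact ENNReal.toReal_mono (ENNReal.mul_ne_top hf.eLpNorm_ne_top hg.eLpNorm_ne_top) holder

variable [IsProbabilityMeasure μ]

theorem lpNorm_mono_exponent (hqr : q ≤ r) (hf : MemLp f r μ) :
    lpNorm f q μ ≤ lpNorm f r μ := by
  rw [← toReal_eLpNorm hf.1, ← toReal_eLpNorm hf.1]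
  exact ENNReal.toReal_mono hf.eLpNorm_ne_top
    (eLpNorm_le_eLpNorm_of_exponent_le (by exact_mod_cast hqr) hf.1)

theorem integrable_abs_rpow (hqr : q ≤ r) (hf : MemLp f r μ) :
    Integrable (fun ω => |f ω| ^ (q : ℝ)) μ := by
  have hfq : MemLp f q μ := hf.mono_exponent (by exact_mod_cast hqr)
  simpa using hfq.integrable_norm_rpow'

theorem integral_abs_rpow_le_lpNorm_rpow (hqr : q ≤ r) (hf : MemLp f r μ) :
    ∫ ω, |f ω| ^ (q : ℝ) ∂μ ≤ lpNorm f r μ ^ (q : ℝ) := by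
  rcases eq_or_ne q 0 with rfl | hq
  · simp
  · rw [← lpNorm_rpow_eq_integral hq hf.1]
    exact Real.rpow_le_rpow lpNorm_nonneg (lpNorm_mono_exponent hqr hf) q.2

theorem lpNorm_sub_integral_le (hr : 1 ≤ r) (hf : MemLp f r μ) :
    lpNorm (fun ω => f ω - ∫ x, f x ∂μ) r μ ≤ 2 * lpNorm f r μ := by
  have h_mean : |∫ x, f x ∂μ| ≤ lpNorm f r μ :=
    calc |∫ x, f x ∂μ| ≤ ∫ x, |f x| ^ ((1 : ℝ≥0) : ℝ) ∂μ := by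
          simpa using abs_integral_le_integral_abs (f := f)
      _ ≤ lpNorm f r μ := by simpa using integral_abs_rpow_le_lpNorm_rpow hr hf
  calc lpNorm (fun ω => f ω - ∫ x, f x ∂μ) r μ
      ≤ lpNorm f r μ + lpNorm (fun _ : Ω => ∫ x, f x ∂μ) r μ :=
        lpNorm_sub_le hf (by exact_mod_cast hr)
    _ = lpNorm f r μ + |∫ x, f x ∂μ| := by
        simp [lpNorm_const (E := ℝ) (p := r) (by positivity) (NeZero.ne μ)]
    _ ≤ 2 * lpNorm f r μ := by linarith

end LpNorm

section TypeTwo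

variable {Ω : Type*} [MeasurableSpace Ω] {μ : Measure Ω} [IsProbabilityMeasure μ] {r : ℝ≥0}

theorem integrable_abs_rpow_sub_two_mul {S : Ω → ℝ} (hr : 2 ≤ r) (hS : MemLp S r μ) :
    Integrable (fun ω => |S ω| ^ ((r : ℝ) - 2) * S ω) μ := by
  have : (2 : ℝ) ≤ r := by exact_mod_cast hr
  have h := integrable_abs_rpow (q := r - 1) tsub_le_self hS
  rw [NNReal.coe_sub (one_le_two.trans hr), NNReal.coe_one] at h
  refine h.mono' ?_ (ae_of_all _ fun ω => ?_)
  · exact ((hS.1.norm.aemeasurable.pow_const _).mul hS.1.aemeasurable).aestronglyMeasurable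
  · rw [norm_mul, Real.norm_eq_abs, Real.norm_eq_abs, abs_of_nonneg (by positivity),
      ← Real.rpow_add_one' (abs_nonneg _) (by linarith)]
    exact (congrArg (fun t => |S ω| ^ t) (by ring)).le

theorem integral_abs_add_rpow_le {S X : Ω → ℝ} (hr : 2 ≤ r) (hS : MemLp S r μ) (hX : MemLp X r μ)
    (hSX : IndepFun S X μ) (hX0 : ∫ ω, X ω ∂μ = 0) :
    ∫ ω, |S ω + X ω| ^ (r : ℝ) ∂μ ≤ ∫ ω, |S ω| ^ (r : ℝ) ∂μ + taylorConst r *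
      ((∫ ω, |S ω| ^ ((r : ℝ) - 2) ∂μ) * ∫ ω, X ω ^ 2 ∂μ + ∫ ω, |X ω| ^ (r : ℝ) ∂μ) := by
  have hr' : (2 : ℝ) ≤ r := by exact_mod_cast hr
  have hSr := integrable_abs_rpow le_rfl hS
  have hXr := integrable_abs_rpow le_rfl hX
  have hX2 : Integrable (fun ω => X ω ^ 2) μ := by simpa using integrable_abs_rpow hr hX
  have hSr2 : Integrable (fun ω => |S ω| ^ ((r : ℝ) - 2)) μ := by
    simpa [NNReal.coe_sub hr] using integrable_abs_rpow (q := r - 2) tsub_le_self hS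
  have hX1 : Integrable X μ := hX.integrable (by exact_mod_cast one_le_two.trans hr)
  have hSr1 := integrable_abs_rpow_sub_two_mul hr hS
  have indep_first : IndepFun (fun ω => |S ω| ^ ((r : ℝ) - 2) * S ω) X μ :=
    hSX.comp (φ := fun x => |x| ^ ((r : ℝ) - 2) * x) (ψ := id) (by fun_prop) measurable_id
  have indep_second : IndepFun (fun ω => |S ω| ^ ((r : ℝ) - 2)) (fun ω => X ω ^ 2) μ :=
    hSX.comp (φ := fun x => |x| ^ ((r : ℝ) - 2)) (ψ := fun x => x ^ 2) (by fun_prop) (by fun_prop)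
  have int_first : Integrable (fun ω => |S ω| ^ ((r : ℝ) - 2) * S ω * X ω) μ :=
    indep_first.integrable_mul hSr1 hX1
  have int_second : Integrable (fun ω => |S ω| ^ ((r : ℝ) - 2) * X ω ^ 2) μ :=
    indep_second.integrable_mul hSr2 hX2
  calc ∫ ω, |S ω + X ω| ^ (r : ℝ) ∂μ
      ≤ ∫ ω, |S ω| ^ (r : ℝ) + r * (|S ω| ^ ((r : ℝ) - 2) * S ω * X ω) +
          taylorConst r * (|S ω| ^ ((r : ℝ) - 2) * X ω ^ 2 + |X ω| ^ (r : ℝ)) ∂μ :=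
        integral_mono (integrable_abs_rpow le_rfl (hS.add hX))
          ((hSr.add (int_first.const_mul _)).add ((int_second.add hXr).const_mul _))
          fun ω => abs_add_rpow_le hr' (S ω) (X ω)
    _ = _ := by
        rw [integral_add (hSr.fun_add (int_first.const_mul _))
            ((int_second.fun_add hXr).const_mul _), integral_add hSr (int_first.const_mul _),
          integral_const_mul, integral_const_mul, integral_add int_second hXr,
          indep_first.integral_fun_mul_eq_mul_integral hSr1.1 hX1.1,
          indep_second.integral_fun_mul_eq_mul_integral hSr2.1 hX2.1, hX0, mul_zero, mul_zero,
          add_zero]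

theorem lpNorm_add_sq_le_of_indepFun {S X : Ω → ℝ} (hr : 2 ≤ r) (hS : MemLp S r μ)
    (hX : MemLp X r μ) (hSX : IndepFun S X μ) (hX0 : ∫ ω, X ω ∂μ = 0) :
    lpNorm (S + X) r μ ^ 2 ≤ lpNorm S r μ ^ 2 + 2 * taylorConst r * lpNorm X r μ ^ 2 := by
  have hr' : (2 : ℝ) ≤ r := by exact_mod_cast hr
  have hr0 : r ≠ 0 := (two_pos.trans_le hr).ne'
  have hC : 1 ≤ taylorConst r := by linarith [le_taylorConst (show 1 ≤ (r : ℝ) by linarith)]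
  have h_S := integral_abs_rpow_le_lpNorm_rpow (q := r - 2) tsub_le_self hS
  rw [NNReal.coe_sub hr, NNReal.coe_ofNat] at h_S
  have h_X : ∫ ω, X ω ^ 2 ∂μ ≤ lpNorm X r μ ^ 2 := by
    simpa using integral_abs_rpow_le_lpNorm_rpow hr hX
  have key : lpNorm (S + X) r μ ^ (r : ℝ) ≤
      (lpNorm S r μ ^ 2 + 2 * taylorConst r * lpNorm X r μ ^ 2) ^ ((r : ℝ) / 2) :=
    calc lpNorm (S + X) r μ ^ (r : ℝ) = ∫ ω, |S ω + X ω| ^ (r : ℝ) ∂μ :=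
          lpNorm_rpow_eq_integral hr0 (hS.add hX).1
      _ ≤ _ := integral_abs_add_rpow_le hr hS hX hSX hX0
      _ ≤ lpNorm S r μ ^ (r : ℝ) + taylorConst r * (lpNorm S r μ ^ ((r : ℝ) - 2) *
            lpNorm X r μ ^ 2 + lpNorm X r μ ^ (r : ℝ)) := by
          rw [lpNorm_rpow_eq_integral hr0 hS.1, lpNorm_rpow_eq_integral hr0 hX.1]
          gcongr
          exact Real.rpow_nonneg lpNorm_nonneg _
      _ ≤ _ := rpow_add_mul_le_add_sq_rpow hr' hC lpNorm_nonneg lpNorm_nonneg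
  rw [← Real.rpow_le_rpow_iff (sq_nonneg _) (by positivity) (show 0 < (r : ℝ) / 2 by linarith)]
  rwa [← Real.rpow_two, ← Real.rpow_mul lpNorm_nonneg, mul_div_cancel₀ _ two_ne_zero]

theorem lpNorm_sum_sq_le_of_iIndepFun {ι : Type*} {X : ι → Ω → ℝ} (hr : 2 ≤ r)
    (hX : ∀ i, MemLp (X i) r μ) (hindep : iIndepFun X μ) (hX0 : ∀ i, ∫ ω, X i ω ∂μ = 0)
    (s : Finset ι) :
    lpNorm (∑ i ∈ s, X i) r μ ^ 2 ≤ 2 * taylorConst r * ∑ i ∈ s, lpNorm (X i) r μ ^ 2 := by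
  classical
  induction s using Finset.induction_on with
  | empty => simp [lpNorm_zero]
  | insert i s hi ih =>
    rw [Finset.sum_insert hi, Finset.sum_insert hi, add_comm (X i)]
    have hs : MemLp (∑ j ∈ s, X j) r μ := memLp_finsetSum' s fun j _ => hX j
    have indep : IndepFun (∑ j ∈ s, X j) (X i) μ :=
      hindep.indepFun_finsetSum_of_notMem₀ (fun j => (hX j).1.aemeasurable) hi
    have h := lpNorm_add_sq_le_of_indepFun hr hs (hX i) indep (hX0 i)
    linarith

end TypeTwo

section AlmostSureRates

open Asymptotics

variable {Ω : Type*} [MeasurableSpace Ω] {μ : Measure Ω} {q : ℝ≥0} {s : ℝ} {Z : ℕ → Ω → ℝ}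

theorem ae_tendsto_zero_of_summable_integral_abs (hZ : ∀ m, Integrable (Z m) μ)
    (hsum : Summable fun m => ∫ ω, |Z m ω| ∂μ) :
    ∀ᵐ ω ∂μ, Tendsto (fun m => Z m ω) atTop (𝓝 0) := by
  have h : ∑' m, eLpNorm (Z m) 1 μ ≠ ∞ := by
    simp_rw [eLpNorm_one_eq_lintegral_enorm,
      ← fun m => ofReal_integral_norm_eq_lintegral_enorm (hZ m)]
    exact hsum.tsum_ofReal_ne_top
  filter_upwards [summable_norm_of_tsum_eLpNorm_ne_top le_rfl (fun m => (hZ m).1) h] with ω hω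
  exact tendsto_zero_iff_norm_tendsto_zero.2 hω.tendsto_atTop_zero

theorem ae_tendsto_zero_of_lpNorm_isBigO (hq : 0 < q) (hsq : 1 < s * q)
    (hZ : ∀ m, MemLp (Z m) q μ)
    (hrate : (fun m => lpNorm (Z m) q μ) =O[atTop] fun m : ℕ => (m : ℝ) ^ (-s)) :
    ∀ᵐ ω ∂μ, Tendsto (fun m => Z m ω) atTop (𝓝 0) := by
  have hq' : (0 : ℝ) < q := by exact_mod_cast hq
  have hint : ∀ m, Integrable (fun ω => |Z m ω| ^ (q : ℝ)) μ := fun m => by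
    simpa using (hZ m).integrable_norm_rpow (by exact_mod_cast hq.ne') ENNReal.coe_ne_top
  have h_isBigO : (fun m => ∫ ω, |Z m ω| ^ (q : ℝ) ∂μ) =O[atTop]
      fun m : ℕ => (m : ℝ) ^ (-(s * q)) := by
    have h := hrate.rpow hq'.le (Eventually.of_forall fun m : ℕ => by positivity)
    refine (h.congr_left fun m => lpNorm_rpow_eq_integral hq.ne' (hZ m).1).congr_right fun m => ?_
    rw [← Real.rpow_mul (by positivity), neg_mul]
  have hsum : Summable fun m => ∫ ω, |Z m ω| ^ (q : ℝ) ∂μ :=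
    summable_of_isBigO_nat (Real.summable_nat_rpow.2 (by linarith)) h_isBigO
  have h := ae_tendsto_zero_of_summable_integral_abs hint
    (by simpa [Real.abs_rpow_of_nonneg] using hsum)
  filter_upwards [h] with ω hω
  have h_root := hω.rpow_const (p := (q : ℝ)⁻¹) (Or.inr (by positivity))
  rw [Real.zero_rpow (by positivity)] at h_root
  exact tendsto_zero_iff_abs_tendsto_zero _ |>.2
    (h_root.congr fun m => Real.rpow_rpow_inv (abs_nonneg _) hq'.ne')

theorem ae_isLittleO_of_lpNorm_isBigO {g : ℕ → ℝ} (hq : 0 < q) (hsq : 1 < s * q)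
    (hZ : ∀ m, MemLp (Z m) q μ) (hg : ∀ᶠ m in atTop, g m ≠ 0)
    (hrate : (fun m => lpNorm (Z m) q μ) =O[atTop] fun m : ℕ => g m * (m : ℝ) ^ (-s)) :
    ∀ᵐ ω ∂μ, (fun m => Z m ω) =o[atTop] g := by
  have hZg : ∀ m, MemLp ((g m)⁻¹ • Z m) q μ := fun m => (hZ m).const_smul _
  have h : ∀ᵐ ω ∂μ, Tendsto (fun m => ((g m)⁻¹ • Z m) ω) atTop (𝓝 0) := by
    refine ae_tendsto_zero_of_lpNorm_isBigO hq hsq hZg ?_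
    refine (((isBigO_refl (fun m => (g m)⁻¹) atTop).norm_left.mul hrate).congr' ?_ ?_)
    · exact Eventually.of_forall fun m => by simp [lpNorm_const_smul]
    · filter_upwards [hg] with m hm using inv_mul_cancel_left₀ hm _
  filter_upwards [h] with ω hω
  rw [isLittleO_iff_tendsto' (hg.mono fun m hm h0 => absurd h0 hm)]
  simpa [div_eq_inv_mul] using hω

end AlmostSureRates

section Independence

variable {Ω ι κ : Type*} [MeasurableSpace Ω] {μ : Measure Ω} [IsProbabilityMeasure μ]

theorem iIndepFun_curry [Countable ι] [Countable κ] {X : ι × κ → Ω → ℝ}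
    (hX : ∀ i, Measurable (X i)) (h : iIndepFun X μ) :
    iIndepFun (fun i ω j => X (i, j) ω) μ := by
  have hP : ∀ i j, IsProbabilityMeasure (μ.map (X (i, j))) := fun i j =>
    Measure.isProbabilityMeasure_map (hX _).aemeasurable
  have h_rows : ∀ i, μ.map (fun ω j => X (i, j) ω) = Measure.infinitePi fun j => μ.map (X (i, j)) :=
    fun i => (iIndepFun_iff_map_fun_eq_infinitePi_map fun j => hX (i, j)).1
      (h.precomp (Prod.mk_right_injective i))
  rw [iIndepFun_iff_map_fun_eq_infinitePi_map (by fun_prop)]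
  simp_rw [h_rows]
  rw [← Measure.infinitePi_map_curry (fun i j => μ.map (X (i, j))),
    ← (iIndepFun_iff_map_fun_eq_infinitePi_map hX).1 h,
    Measure.map_map (by fun_prop) (by fun_prop)]
  rfl

end Independence

section WhiteNoise

open Matrix

variable {Ω α β κ : Type*} [MeasurableSpace Ω]

/-- A family of random matrices is white noise when all the entries of all its members are jointly
independent, centered and of unit variance; the `L^r` norms of the entries are moreover required to
be bounded by `K`. -/
structure IsWhiteNoise (μ : Measure Ω) (r : ℝ≥0) (K : ℝ) (E : κ → Ω → Matrix α β ℝ) : Prop where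
  measurable : ∀ k i j, Measurable fun ω => E k ω i j
  iIndepFun : iIndepFun (fun (t : κ × α × β) ω => E t.1 ω t.2.1 t.2.2) μ
  integral_eq_zero : ∀ k i j, ∫ ω, E k ω i j ∂μ = 0
  integral_sq_eq_one : ∀ k i j, ∫ ω, E k ω i j ^ 2 ∂μ = 1
  memLp : ∀ k i j, MemLp (fun ω => E k ω i j) r μ
  lpNorm_le : ∀ k i j, lpNorm (fun ω => E k ω i j) r μ ≤ K

theorem trace_mul_transpose_eq_sum [Fintype α] [Fintype β] (X Y : Matrix α β ℝ) :
    (X * Yᵀ).trace = ∑ i, ∑ j, X i j * Y i j :=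
  (sum_hadamard_eq X Y).symm

theorem trace_mul_transpose_self_nonneg [Fintype α] [Fintype β] (X : Matrix α β ℝ) :
    0 ≤ (X * Xᵀ).trace := by
  rw [trace_mul_transpose_eq_sum]
  exact Finset.sum_nonneg fun i _ => Finset.sum_nonneg fun j _ => mul_self_nonneg (X i j)

open scoped Matrix.Norms.Frobenius in
theorem trace_mul_transpose_self_eq_norm_sq [Fintype α] [Fintype β] (X : Matrix α β ℝ) :
    (X * Xᵀ).trace = ‖X‖ ^ 2 := by
  rw [trace_mul_transpose_eq_sum, frobenius_norm_def, ← Real.sqrt_eq_rpow,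
    Real.sq_sqrt (by positivity)]
  simp [sq]

open scoped Matrix.Norms.Frobenius in
theorem trace_transpose_mul_mul_transpose_le [Fintype α] [Fintype β] (R : Matrix α α ℝ)
    (B : Matrix α β ℝ) :
    ((Rᵀ * B) * (Rᵀ * B)ᵀ).trace ≤ (R * Rᵀ).trace * (B * Bᵀ).trace := by
  simp only [trace_mul_transpose_self_eq_norm_sq]
  rw [← mul_pow, ← frobenius_norm_transpose R]
  gcongr
  exact frobenius_norm_mul Rᵀ B

variable {μ : Measure Ω} {q r : ℝ≥0} {K : ℝ} {E : κ → Ω → Matrix α β ℝ}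

theorem IsWhiteNoise.memLp_mul_apply [Fintype α] (hE : IsWhiteNoise μ r K E) (R : Matrix α α ℝ)
    (k : κ) (i : α) (j : β) : MemLp (fun ω => (R * E k ω) i j) r μ := by
  simp only [mul_apply]
  exact memLp_finsetSum _ fun a _ => (hE.memLp k a j).const_mul (R i a)

instance holderTriple_two_mul (q : ℝ≥0) :
    ENNReal.HolderTriple ((2 * q : ℝ≥0) : ℝ≥0∞) (2 * q : ℝ≥0) q where
  inv_add_inv_eq_inv := by
    rw [ENNReal.coe_mul, ENNReal.mul_inv (by simp) (by simp), ← add_mul]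
    simp [ENNReal.inv_two_add_inv_two]

theorem IsWhiteNoise.memLp_mul_mul_apply [Fintype α] (hE : IsWhiteNoise μ (2 * q) K E)
    (R : Matrix α α ℝ) (k l : κ) (i : α) (j : β) :
    MemLp (fun ω => (R * E k ω) i j * (R * E l ω) i j) q μ :=
  (hE.memLp_mul_apply R l i j).mul (hE.memLp_mul_apply R k i j)

theorem IsWhiteNoise.integrable_mul [IsFiniteMeasure μ] (hE : IsWhiteNoise μ r K E) (hr : 2 ≤ r)
    (k l : κ) (i i' : α) (j j' : β) : Integrable (fun ω => E k ω i j * E l ω i' j') μ := by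
  have hL2 : ∀ k i j, MemLp (fun ω => E k ω i j) 2 μ := fun k i j =>
    (hE.memLp k i j).mono_exponent (by exact_mod_cast hr)
  exact (hL2 k i j).integrable_mul (hL2 l i' j')

theorem IsWhiteNoise.integral_mul [DecidableEq κ] [DecidableEq α] (hE : IsWhiteNoise μ r K E)
    (k l : κ) (i i' : α) (j : β) :
    ∫ ω, E k ω i j * E l ω i' j ∂μ = if k = l ∧ i = i' then 1 else 0 := by
  split_ifs with h
  · obtain ⟨rfl, rfl⟩ := h
    simpa only [sq] using hE.integral_sq_eq_one k i j
  · have hindep : IndepFun (fun ω => E k ω i j) (fun ω => E l ω i' j) μ :=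
      hE.iIndepFun.indepFun (i := (k, i, j)) (j := (l, i', j)) (by simpa using h)
    rw [hindep.integral_fun_mul_eq_mul_integral (hE.memLp _ _ _).1 (hE.memLp _ _ _).1,
      hE.integral_eq_zero, zero_mul]

theorem IsWhiteNoise.integral_sum_mul [Fintype α] [DecidableEq κ] [IsFiniteMeasure μ]
    (hE : IsWhiteNoise μ r K E) (hr : 2 ≤ r) (R : Matrix α α ℝ) (k l : κ) (j : β) :
    ∫ ω, ∑ i, (R * E k ω) i j * (R * E l ω) i j ∂μ = if k = l then (R * Rᵀ).trace else 0 := by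
  classical
  have hint : ∀ i a b, Integrable (fun ω => R i a * R i b * (E k ω a j * E l ω b j)) μ :=
    fun i a b => (hE.integrable_mul hr k l a b j j).const_mul _
  have expand : ∀ ω, ∑ i, (R * E k ω) i j * (R * E l ω) i j =
      ∑ i, ∑ a, ∑ b, R i a * R i b * (E k ω a j * E l ω b j) := fun ω => by
    simp only [mul_apply, Finset.sum_mul_sum, mul_mul_mul_comm]
  simp only [expand]
  rw [integral_finsetSum _ fun i _ => integrable_finsetSum _ fun a _ =>
    integrable_finsetSum _ fun b _ => hint i a b]
  simp only [integral_finsetSum _ fun a _ => integrable_finsetSum _ fun b _ => hint _ a b,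
    integral_finsetSum _ fun b _ => hint _ _ b, integral_const_mul, hE.integral_mul]
  rcases eq_or_ne k l with h | h <;> simp [h, trace_mul_transpose_eq_sum]

variable [IsProbabilityMeasure μ]

theorem IsWhiteNoise.iIndepFun_sum_mul [Fintype α] [Countable κ] [Countable β]
    (hE : IsWhiteNoise μ r K E) (R : Matrix α α ℝ) (k l : κ) :
    ProbabilityTheory.iIndepFun (fun j ω => ∑ i, (R * E k ω) i j * (R * E l ω) i j) μ := by
  have reindex : Function.Injective fun t : β × κ × α => (t.2.1, t.2.2, t.1) :=
    fun s t h => by simp_all [Prod.ext_iff]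
  have columns : ProbabilityTheory.iIndepFun
      (fun (j : β) ω (t : κ × α) => E t.1 ω t.2 j) μ :=
    iIndepFun_curry (fun t => hE.measurable _ _ _) (hE.iIndepFun.precomp reindex)
  exact columns.comp (fun _ x => ∑ i, (∑ a, R i a * x (k, a)) * ∑ a, R i a * x (l, a))
    fun _ => by fun_prop

theorem IsWhiteNoise.lpNorm_sum_smul_sq_le {ι : Type*} [Fintype ι] (hE : IsWhiteNoise μ r K E)
    (hr : 2 ≤ r) (u : ι → ℝ) {f : ι → κ × α × β} (hf : f.Injective) :
    lpNorm (fun ω => ∑ i, u i * E (f i).1 ω (f i).2.1 (f i).2.2) r μ ^ 2 ≤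
      2 * taylorConst r * K ^ 2 * ∑ i, u i ^ 2 := by
  let X : ι → Ω → ℝ := fun i ω => u i * E (f i).1 ω (f i).2.1 (f i).2.2
  have hX : ∀ i, MemLp (X i) r μ := fun i => (hE.memLp _ _ _).const_mul (u i)
  have hindep : ProbabilityTheory.iIndepFun X μ :=
    (hE.iIndepFun.precomp hf).comp (fun i x => u i * x) fun i => by fun_prop
  have hX0 : ∀ i, ∫ ω, X i ω ∂μ = 0 := fun i => by
    rw [integral_const_mul, hE.integral_eq_zero, mul_zero]
  have hnorm : ∀ i, lpNorm (X i) r μ ^ 2 ≤ K ^ 2 * u i ^ 2 := fun i => by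
    calc lpNorm (X i) r μ ^ 2
        = u i ^ 2 * lpNorm (fun ω => E (f i).1 ω (f i).2.1 (f i).2.2) r μ ^ 2 := by
          rw [← sq_abs (u i), ← mul_pow]
          exact congrArg (· ^ 2) (lpNorm_const_smul (u i) _ μ)
      _ ≤ u i ^ 2 * K ^ 2 := by
          gcongr
          · exact lpNorm_nonneg
          · exact hE.lpNorm_le _ _ _
      _ = K ^ 2 * u i ^ 2 := mul_comm _ _
  calc lpNorm (fun ω => ∑ i, X i ω) r μ ^ 2 = lpNorm (∑ i, X i) r μ ^ 2 := by
        rw [Finset.sum_fn]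
    _ ≤ 2 * taylorConst r * ∑ i, lpNorm (X i) r μ ^ 2 :=
        lpNorm_sum_sq_le_of_iIndepFun hr hX hindep hX0 Finset.univ
    _ ≤ 2 * taylorConst r * ∑ i, K ^ 2 * u i ^ 2 := by
        gcongr with i
        · exact mul_nonneg two_pos.le (taylorConst_nonneg _)
        · exact hnorm i
    _ = 2 * taylorConst r * K ^ 2 * ∑ i, u i ^ 2 := by
        rw [← Finset.mul_sum]
        ring

variable [Fintype α]

theorem IsWhiteNoise.lpNorm_mul_apply_sq_le (hE : IsWhiteNoise μ r K E) (hr : 2 ≤ r)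
    (R : Matrix α α ℝ) (k : κ) (i : α) (j : β) :
    lpNorm (fun ω => (R * E k ω) i j) r μ ^ 2 ≤ 2 * taylorConst r * K ^ 2 * ∑ a, R i a ^ 2 := by
  simp only [mul_apply]
  exact hE.lpNorm_sum_smul_sq_le hr (R i) (f := fun a => (k, a, j)) fun a b h => by simpa using h

theorem IsWhiteNoise.lpNorm_trace_sq_le [Fintype β] (hE : IsWhiteNoise μ r K E) (hr : 2 ≤ r)
    (R : Matrix α α ℝ) (B : Matrix α β ℝ) (k : κ) :
    lpNorm (fun ω => (B * (R * E k ω)ᵀ).trace) r μ ^ 2 ≤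
      2 * taylorConst r * K ^ 2 * ((R * Rᵀ).trace * (B * Bᵀ).trace) := by
  have h_trace : ∀ ω, (B * (R * E k ω)ᵀ).trace =
      ∑ t : α × β, (Rᵀ * B) t.1 t.2 * E k ω t.1 t.2 := fun ω => by
    rw [transpose_mul, ← Matrix.mul_assoc, trace_mul_comm, ← Matrix.mul_assoc,
      trace_mul_transpose_eq_sum]
    exact (Fintype.sum_prod_type' fun i j => (Rᵀ * B) i j * E k ω i j).symm
  have h_sum : ∑ t : α × β, (Rᵀ * B) t.1 t.2 ^ 2 = ((Rᵀ * B) * (Rᵀ * B)ᵀ).trace := by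
    simp only [trace_mul_transpose_eq_sum, ← sq]
    exact Fintype.sum_prod_type' fun i j => (Rᵀ * B) i j ^ 2
  simp only [h_trace]
  refine (hE.lpNorm_sum_smul_sq_le hr (fun t : α × β => (Rᵀ * B) t.1 t.2)
    (f := fun t => (k, t.1, t.2)) (Prod.mk_right_injective k)).trans ?_
  rw [h_sum]
  gcongr
  · have := taylorConst_nonneg r
    positivity
  · exact trace_transpose_mul_mul_transpose_le R B

theorem IsWhiteNoise.lpNorm_sum_mul_le (hE : IsWhiteNoise μ (2 * q) K E) (hq : 1 ≤ q)
    (R : Matrix α α ℝ) (k l : κ) (j : β) :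
    lpNorm (fun ω => ∑ i, (R * E k ω) i j * (R * E l ω) i j) q μ ≤
      2 * taylorConst (2 * q) * K ^ 2 * (R * Rᵀ).trace := by
  have hq2 : (2 : ℝ≥0) ≤ 2 * q := by simpa using mul_le_mul_right hq 2
  calc lpNorm (fun ω => ∑ i, (R * E k ω) i j * (R * E l ω) i j) q μ
      ≤ ∑ i, lpNorm (fun ω => (R * E k ω) i j * (R * E l ω) i j) q μ := by
        simpa only [Finset.sum_fn] using lpNorm_sum_le
          (fun i _ => hE.memLp_mul_mul_apply R k l i j) (by exact_mod_cast hq)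
    _ ≤ ∑ i, 2 * taylorConst (2 * q) * K ^ 2 * ∑ a, R i a ^ 2 := by
        gcongr with i
        refine (lpNorm_mul_le (hE.memLp_mul_apply R k i j) (hE.memLp_mul_apply R l i j)).trans ?_
        have hk := hE.lpNorm_mul_apply_sq_le hq2 R k i j
        have hl := hE.lpNorm_mul_apply_sq_le hq2 R l i j
        rw [NNReal.coe_mul, NNReal.coe_ofNat] at hk hl
        linarith [two_mul_le_add_sq (lpNorm (fun ω => (R * E k ω) i j) (2 * q : ℝ≥0) μ)
          (lpNorm (fun ω => (R * E l ω) i j) (2 * q : ℝ≥0) μ)]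
    _ = 2 * taylorConst (2 * q) * K ^ 2 * (R * Rᵀ).trace := by
        simp only [← Finset.mul_sum, trace_mul_transpose_eq_sum, sq]

theorem IsWhiteNoise.lpNorm_trace_sub_sq_le [DecidableEq κ] [Countable κ] [Fintype β]
    (hE : IsWhiteNoise μ (2 * q) K E) (hq : 2 ≤ q) (R : Matrix α α ℝ) (k l : κ) :
    lpNorm (fun ω => (R * E k ω * (R * E l ω)ᵀ).trace -
        Fintype.card β * if k = l then (R * Rᵀ).trace else 0) q μ ^ 2 ≤
      2 * taylorConst q *
        (Fintype.card β * (4 * taylorConst (2 * q) * K ^ 2 * (R * Rᵀ).trace) ^ 2) := by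
  have hq1 : 1 ≤ q := one_le_two.trans hq
  have hq2 : 2 ≤ 2 * q := by simpa using mul_le_mul_right hq1 2
  let Q : β → Ω → ℝ := fun j ω => ∑ i, (R * E k ω) i j * (R * E l ω) i j
  let c : ℝ := if k = l then (R * Rᵀ).trace else 0
  have hQ : ∀ j, MemLp (Q j) q μ := fun j =>
    memLp_finsetSum _ fun i _ => hE.memLp_mul_mul_apply R k l i j
  have hQ_mean : ∀ j, ∫ ω, Q j ω ∂μ = c := fun j => hE.integral_sum_mul hq2 R k l j
  have hX : ∀ j, MemLp (fun ω => Q j ω - c) q μ := fun j => (hQ j).sub (memLp_const c)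
  have hX_mean : ∀ j, ∫ ω, (Q j ω - c) ∂μ = 0 := fun j => by
    rw [integral_sub ((hQ j).integrable (by exact_mod_cast hq1)) (integrable_const c), hQ_mean j]
    simp
  have hX_indep : ProbabilityTheory.iIndepFun (fun j ω => Q j ω - c) μ :=
    (hE.iIndepFun_sum_mul R k l).comp (fun _ x => x - c) fun _ => by fun_prop
  have hX_norm : ∀ j, lpNorm (fun ω => Q j ω - c) q μ ≤
      4 * taylorConst (2 * q) * K ^ 2 * (R * Rᵀ).trace := fun j => by
    have h := lpNorm_sub_integral_le hq1 (hQ j)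
    rw [hQ_mean j] at h
    linarith [hE.lpNorm_sum_mul_le hq1 R k l j]
  have h_trace : (fun ω => (R * E k ω * (R * E l ω)ᵀ).trace - Fintype.card β * c) =
      ∑ j, fun ω => Q j ω - c := by
    ext ω
    rw [trace_mul_transpose_eq_sum, Finset.sum_comm, Finset.sum_apply, Finset.sum_sub_distrib]
    simp [Q]
  rw [h_trace]
  refine (lpNorm_sum_sq_le_of_iIndepFun hq hX hX_indep hX_mean Finset.univ).trans ?_
  gcongr
  · exact mul_nonneg two_pos.le (taylorConst_nonneg _)
  · refine (Finset.sum_le_card_nsmul _ _ _ fun j _ =>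
      pow_le_pow_left₀ lpNorm_nonneg (hX_norm j) 2).trans_eq ?_
    simp

end WhiteNoise

section NormTrace

variable {n m p : ℕ} (A B X Y Z : Matrix (Fin m) (Fin p) ℝ)

theorem normTrace_comm : normTrace X Y = normTrace Y X := by
  rw [normTrace, normTrace, ← Matrix.trace_transpose, Matrix.transpose_mul,
    Matrix.transpose_transpose]

theorem normTrace_self_nonneg : 0 ≤ normTrace X X :=
  mul_nonneg (by positivity) (trace_mul_transpose_self_nonneg X)

theorem normTrace_add_left : normTrace (X + Y) Z = normTrace X Z + normTrace Y Z := by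
  simp only [normTrace, Matrix.add_mul, Matrix.trace_add, mul_add]

theorem normTrace_add_right : normTrace X (Y + Z) = normTrace X Y + normTrace X Z := by
  simp only [normTrace_comm X, normTrace_add_left]

theorem normTrace_smul_left (a : ℝ) : normTrace (a • X) Y = a * normTrace X Y := by
  simp only [normTrace, Matrix.smul_mul, Matrix.trace_smul, smul_eq_mul, mul_left_comm]

theorem normTrace_sub_left : normTrace (X - Y) Z = normTrace X Z - normTrace Y Z := by
  simp only [normTrace, Matrix.sub_mul, Matrix.trace_sub, mul_sub]

theorem normTrace_sub_right : normTrace X (Y - Z) = normTrace X Y - normTrace X Z := by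
  simp only [normTrace_comm X, normTrace_sub_left]

theorem normTrace_sum_left (W : Fin n → Matrix (Fin m) (Fin p) ℝ) :
    normTrace (∑ k, W k) Y = ∑ k, normTrace (W k) Y := by
  simp only [normTrace, Matrix.sum_mul, Matrix.trace_sum, Finset.mul_sum]

theorem normTrace_ones_self_of_ne_zero (hm : m ≠ 0) (hp : p ≠ 0) :
    normTrace (onesMatrix m p) (onesMatrix m p) = 1 := by
  simp only [normTrace, trace_mul_transpose_eq_sum, onesMatrix, Matrix.of_apply, mul_one,
    Finset.sum_const, Finset.card_univ, Fintype.card_fin, nsmul_eq_mul]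
  field_simp

theorem normTrace_eq_zero_of_eq_zero (h : m = 0 ∨ p = 0) : normTrace X Y = 0 := by
  rcases h with rfl | rfl <;> simp [normTrace]

theorem normTrace_ones_self_le_one : normTrace (onesMatrix m p) (onesMatrix m p) ≤ 1 := by
  by_cases h : m = 0 ∨ p = 0
  · rw [normTrace_eq_zero_of_eq_zero _ _ h]
    exact zero_le_one
  · rw [not_or] at h
    exact (normTrace_ones_self_of_ne_zero h.1 h.2).le

/-- The part of `A` orthogonal to the matrix of ones: all its entries are shifted so that they sum
to zero. -/
noncomputable def centered (A : Matrix (Fin m) (Fin p) ℝ) : Matrix (Fin m) (Fin p) ℝ :=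
  A - normTrace A (onesMatrix m p) • onesMatrix m p

theorem normTrace_centered_left :
    normTrace (centered A) B =
      normTrace A B - normTrace A (onesMatrix m p) * normTrace B (onesMatrix m p) := by
  rw [centered, normTrace_sub_left, normTrace_smul_left, normTrace_comm (onesMatrix m p) B]

theorem normTrace_centered_self :
    normTrace (centered A) (centered A) =
      normTrace A A - normTrace A (onesMatrix m p) ^ 2 := by
  have h_ones : normTrace A (onesMatrix m p) * normTrace (centered A) (onesMatrix m p) = 0 := by
    rw [normTrace_centered_left]
    by_cases h : m = 0 ∨ p = 0
    · rw [normTrace_eq_zero_of_eq_zero A _ h, zero_mul]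
    · rw [not_or] at h
      rw [normTrace_ones_self_of_ne_zero h.1 h.2]
      ring
  rw [normTrace_centered_left, normTrace_comm A (centered A), normTrace_centered_left, h_ones]
  ring

theorem sq_normTrace_ones_le : normTrace A (onesMatrix m p) ^ 2 ≤ normTrace A A := by
  linarith [normTrace_centered_self A, normTrace_self_nonneg (centered A)]

end NormTrace

section SampleVariance

variable {n m p : ℕ} (A : Matrix (Fin m) (Fin p) ℝ) (W X : Fin n → Matrix (Fin m) (Fin p) ℝ)

theorem sampleMean_const_add (hn : n ≠ 0) :
    sampleMean (fun k => A + W k) = A + sampleMean W := by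
  simp [sampleMean, Finset.sum_add_distrib, ← Nat.cast_smul_eq_nsmul ℝ, hn]

theorem normTrace_sampleMean_left (Y : Matrix (Fin m) (Fin p) ℝ) :
    normTrace (sampleMean W) Y = 1 / n * ∑ k, normTrace (W k) Y := by
  rw [sampleMean, normTrace_smul_left, normTrace_sum_left]

theorem normTrace_sampleMean_self :
    normTrace (sampleMean W) (sampleMean W) = 1 / n ^ 2 * ∑ k, ∑ l, normTrace (W k) (W l) := by
  simp only [normTrace_sampleMean_left, normTrace_comm _ (sampleMean W), ← Finset.mul_sum]
  rw [Finset.sum_comm]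
  ring

theorem sum_normTrace_sub_sampleMean (hn : n ≠ 0) :
    ∑ k, normTrace (X k - sampleMean X) (X k - sampleMean X) =
      ∑ k, normTrace (X k) (X k) - n * normTrace (sampleMean X) (sampleMean X) := by
  have h_mean : ∑ k, normTrace (X k) (sampleMean X) =
      n * normTrace (sampleMean X) (sampleMean X) := by
    rw [normTrace_sampleMean_left]
    field_simp
  simp only [normTrace_sub_left, normTrace_sub_right, Finset.sum_sub_distrib,
    normTrace_comm (sampleMean X) (X _), h_mean, Finset.sum_const, Finset.card_univ,
    Fintype.card_fin, nsmul_eq_mul]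
  ring

theorem pooledEstimator_eq :
    pooledEstimator X =
      1 / ((n : ℝ) - 1) * ∑ k, normTrace (X k - sampleMean X) (X k - sampleMean X) := by
  simp only [pooledEstimator, normTrace, ← Finset.mul_sum, one_div, mul_inv, mul_assoc]

theorem one_sub_alphaHat : 1 - alphaHat X = 1 / n * pooledEstimator X / hatDenominator X := by
  simp only [alphaHat, pooledEstimator, one_div, mul_inv, mul_assoc, sub_sub_cancel]

theorem pooledEstimator_const_add (hn : n ≠ 0) :
    pooledEstimator (fun k => A + W k) = 1 / ((n : ℝ) - 1) *
      (∑ k, normTrace (W k) (W k) - n * normTrace (sampleMean W) (sampleMean W)) := by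
  rw [pooledEstimator_eq, sampleMean_const_add A W hn, ← sum_normTrace_sub_sampleMean W hn]
  simp only [add_sub_add_left_eq_sub]

theorem hatDenominator_const_add (hn : n ≠ 0) :
    hatDenominator (fun k => A + W k) =
      normTrace (centered A) (centered A) + normTrace (sampleMean W) (sampleMean W) +
        2 * normTrace (centered A) (sampleMean W) -
        normTrace (sampleMean W) (onesMatrix m p) ^ 2 := by
  rw [hatDenominator, sampleMean_const_add A W hn, normTrace_centered_self,
    normTrace_centered_left]
  simp only [normTrace_add_left, normTrace_add_right, normTrace_comm (sampleMean W) A]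
  ring

end SampleVariance

section NormalizedNoise

variable {Ω κ : Type*} [MeasurableSpace Ω] {μ : Measure Ω} {q r : ℝ≥0} {K : ℝ} {m p : ℕ}
  {E : κ → Ω → Matrix (Fin m) (Fin p) ℝ}

/-- The noise level `tr(Σ) / m`: the average variance of the entries of `Σ^{1/2} E`. -/
noncomputable def noiseLevel (S : Matrix (Fin m) (Fin m) ℝ) : ℝ := 1 / (m : ℝ) * S.trace

theorem noiseLevel_nonneg {S : Matrix (Fin m) (Fin m) ℝ} (hS : S.PosSemidef) : 0 ≤ noiseLevel S :=
  mul_nonneg (by positivity) hS.trace_nonneg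

theorem noiseLevel_pos {S : Matrix (Fin m) (Fin m) ℝ} (hm : m ≠ 0) (hS : S.PosDef) :
    0 < noiseLevel S := by
  have : NeZero m := ⟨hm⟩
  exact mul_pos (by positivity) hS.trace_pos

theorem memLp_normTrace_mul (hE : IsWhiteNoise μ r K E) (B : Matrix (Fin m) (Fin p) ℝ)
    (R : Matrix (Fin m) (Fin m) ℝ) (k : κ) : MemLp (fun ω => normTrace B (R * E k ω)) r μ := by
  simp only [normTrace, trace_mul_transpose_eq_sum]
  exact (memLp_finsetSum _ fun i _ => memLp_finsetSum _ fun j _ =>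
    (hE.memLp_mul_apply R k i j).const_mul _).const_mul _

theorem memLp_normTrace_mul_mul (hE : IsWhiteNoise μ (2 * q) K E)
    (R : Matrix (Fin m) (Fin m) ℝ) (k l : κ) :
    MemLp (fun ω => normTrace (R * E k ω) (R * E l ω)) q μ := by
  simp only [normTrace, trace_mul_transpose_eq_sum]
  exact (memLp_finsetSum _ fun i _ => memLp_finsetSum _ fun j _ =>
    hE.memLp_mul_mul_apply R k l i j).const_mul _

variable [IsProbabilityMeasure μ]

theorem lpNorm_normTrace_mul_sq_le (hE : IsWhiteNoise μ r K E) (hr : 2 ≤ r)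
    (B : Matrix (Fin m) (Fin p) ℝ) (R : Matrix (Fin m) (Fin m) ℝ) (k : κ) :
    lpNorm (fun ω => normTrace B (R * E k ω)) r μ ^ 2 ≤
      2 * taylorConst r * K ^ 2 * (noiseLevel (R * R.transpose) * normTrace B B) / p := by
  have h_smul : lpNorm (fun ω => normTrace B (R * E k ω)) r μ =
      1 / (m * p : ℝ) * lpNorm (fun ω => (B * (R * E k ω).transpose).trace) r μ := by
    refine (lpNorm_const_smul (1 / (m * p : ℝ)) _ μ).trans ?_
    rw [coe_nnnorm, Real.norm_of_nonneg (by positivity)]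
  rw [h_smul, mul_pow]
  refine (mul_le_mul_of_nonneg_left (hE.lpNorm_trace_sq_le hr R B k) (by positivity)).trans_eq ?_
  simp only [noiseLevel, normTrace, mul_inv, div_eq_mul_inv]
  ring

theorem lpNorm_normTrace_mul_mul_sub_sq_le [DecidableEq κ] [Countable κ]
    (hE : IsWhiteNoise μ (2 * q) K E) (hq : 2 ≤ q) (hp : p ≠ 0)
    (R : Matrix (Fin m) (Fin m) ℝ) (k l : κ) :
    lpNorm (fun ω => normTrace (R * E k ω) (R * E l ω) -
        if k = l then noiseLevel (R * R.transpose) else 0) q μ ^ 2 ≤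
      2 * taylorConst q * (4 * taylorConst (2 * q) * K ^ 2) ^ 2 *
        noiseLevel (R * R.transpose) ^ 2 / p := by
  have h_smul : (fun ω => normTrace (R * E k ω) (R * E l ω) -
      if k = l then noiseLevel (R * R.transpose) else 0) =
      (1 / (m * p : ℝ)) • fun ω => (R * E k ω * (R * E l ω).transpose).trace -
        Fintype.card (Fin p) * if k = l then (R * R.transpose).trace else 0 := by
    ext ω
    simp only [normTrace, noiseLevel, Pi.smul_apply, smul_eq_mul, Fintype.card_fin]
    split_ifs
    · field_simp
    · ring
  rw [h_smul, lpNorm_const_smul, mul_pow, coe_nnnorm,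
    Real.norm_of_nonneg (by positivity)]
  refine (mul_le_mul_of_nonneg_left (hE.lpNorm_trace_sub_sq_le hq R k l)
    (by positivity)).trans_eq ?_
  simp only [noiseLevel, Fintype.card_fin]
  field_simp

end NormalizedNoise

section RatioLimits

open Asymptotics

variable {ι : Type*} {l : Filter ι} {x y D G : ι → ℝ}

theorem eventually_ne_zero_of_sub_isLittleO (hD : (fun i => D i - G i) =o[l] G)
    (hG : ∀ᶠ i in l, G i ≠ 0) : ∀ᶠ i in l, D i ≠ 0 := by
  filter_upwards [hG, (IsLittleO.isEquivalent hD).isBigO_symm.eq_zero_imp] with i hi h h0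
  exact hi (h h0)

theorem tendsto_div_sub_div_zero (hD : (fun i => D i - G i) =o[l] G)
    (hxy : (fun i => x i - y i) =o[l] G) (hy : y =O[l] G) (hG : ∀ᶠ i in l, G i ≠ 0) :
    Tendsto (fun i => x i / D i - y i / G i) l (𝓝 0) := by
  have h_num : (fun i => (x i - y i) * G i - y i * (D i - G i)) =o[l] fun i => G i * G i :=
    (hxy.mul_isBigO (isBigO_refl G l)).sub (hy.mul_isLittleO hD)
  have h_den : (fun i => G i * G i) =O[l] fun i => D i * G i :=
    (IsLittleO.isEquivalent hD).isBigO_symm.mul (isBigO_refl G l)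
  refine (h_num.trans_isBigO h_den).tendsto_div_nhds_zero.congr' ?_
  filter_upwards [hG, eventually_ne_zero_of_sub_isLittleO hD hG] with i hGi hDi
  field_simp
  ring

theorem isBigO_natCast_of_tendsto_div {p : ℕ → ℕ} {c : ℝ} (hp : Tendsto p atTop atTop)
    (h : Tendsto (fun m : ℕ => (m : ℝ) / p m) atTop (𝓝 c)) :
    (fun m : ℕ => (m : ℝ)) =O[atTop] fun m => (p m : ℝ) :=
  isBigO_of_div_tendsto_nhds ((hp.eventually_ne_atTop 0).mono fun _ hm h0 =>
    absurd (Nat.cast_eq_zero.1 h0) hm) c h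

end RatioLimits

section AsymptoticallyWhite

open Asymptotics

/-- The quantity to which the denominator of `alphaHat` is asymptotic, for the signal `A`, the noise
level `t` and `n` observations. -/
noncomputable def oracleDenominator {m p : ℕ} (n : ℕ) (A : Matrix (Fin m) (Fin p) ℝ) (t : ℝ) : ℝ :=
  normTrace (centered A) (centered A) + t / n

section OracleDenominator

variable {n m p : ℕ} (A : Matrix (Fin m) (Fin p) ℝ) {t : ℝ}

theorem oracleDenominator_pos (hn : n ≠ 0) (ht : 0 < t) : 0 < oracleDenominator n A t :=
  add_pos_of_nonneg_of_pos (normTrace_self_nonneg _) (by positivity)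

theorem le_mul_oracleDenominator (hn : n ≠ 0) : t ≤ n * oracleDenominator n A t := by
  have h := mul_nonneg n.cast_nonneg (normTrace_self_nonneg (centered A))
  rw [oracleDenominator, mul_add, mul_div_cancel₀ t (by positivity)]
  linarith

theorem mul_normTrace_centered_le (hn : n ≠ 0) (ht : 0 ≤ t) :
    t * normTrace (centered A) (centered A) ≤ n * oracleDenominator n A t ^ 2 := by
  have hv := normTrace_self_nonneg (centered A)
  have hG : normTrace (centered A) (centered A) ≤ oracleDenominator n A t :=
    le_add_of_nonneg_right (by positivity)
  calc t * normTrace (centered A) (centered A)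
      ≤ n * oracleDenominator n A t * oracleDenominator n A t :=
        mul_le_mul (le_mul_oracleDenominator A hn) hG hv
          (ht.trans (le_mul_oracleDenominator A hn))
    _ = n * oracleDenominator n A t ^ 2 := by ring

theorem one_sub_alphaOracle (S : Matrix (Fin m) (Fin m) ℝ)
    (hG : oracleDenominator n A (noiseLevel S) ≠ 0) :
    1 - alphaOracle n A S = noiseLevel S / n / oracleDenominator n A (noiseLevel S) := by
  have hα : alphaOracle n A S =
      normTrace (centered A) (centered A) / oracleDenominator n A (noiseLevel S) := by
    rw [alphaOracle, oracleDenominator, normTrace_centered_self, noiseLevel]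
    ring
  rw [hα, eq_div_iff hG, sub_mul, div_mul_cancel₀ _ hG, oracleDenominator]
  ring

end OracleDenominator

/-- The deterministic properties of a realization `W` of the noise matrices on which consistency
rests: up to errors negligible against the noise level `t`, the matrices are orthogonal to each
other and of squared length `t`, and they are nearly orthogonal to the matrix of ones and to the
centered signal. -/
structure IsAsymptoticallyWhite {n : ℕ} {p : ℕ → ℕ} (A : (m : ℕ) → Matrix (Fin m) (Fin (p m)) ℝ)
    (t : ℕ → ℝ) (W : (m : ℕ) → Fin n → Matrix (Fin m) (Fin (p m)) ℝ) : Prop where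
  gram : ∀ k l, (fun m => normTrace (W m k) (W m l) - if k = l then t m else 0) =o[atTop] t
  ones : ∀ k, (fun m => normTrace (onesMatrix m (p m)) (W m k)) =o[atTop] fun m => √(t m)
  signal : ∀ k, (fun m => normTrace (centered (A m)) (W m k)) =o[atTop]
    fun m => oracleDenominator n (A m) (t m)

variable {n : ℕ} {p : ℕ → ℕ} {A B : (m : ℕ) → Matrix (Fin m) (Fin (p m)) ℝ} {t : ℕ → ℝ}
  {W : (m : ℕ) → Fin n → Matrix (Fin m) (Fin (p m)) ℝ}

theorem isLittleO_normTrace_sampleMean {g : ℕ → ℝ}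
    (h : ∀ k, (fun m => normTrace (B m) (W m k)) =o[atTop] g) :
    (fun m => normTrace (B m) (sampleMean (W m))) =o[atTop] g := by
  simp only [normTrace_comm (B _), normTrace_sampleMean_left]
  refine (IsLittleO.fun_sum fun k _ => ?_).const_mul_left _
  simpa only [normTrace_comm (B _)] using h k

theorem IsAsymptoticallyWhite.normTrace_sampleMean_self_sub_isLittleO
    (hW : IsAsymptoticallyWhite A t W) :
    (fun m => normTrace (sampleMean (W m)) (sampleMean (W m)) - t m / n) =o[atTop] t := by
  have h_sum : (fun m => ∑ k, ∑ l, (normTrace (W m k) (W m l) - if k = l then t m else 0))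
      =o[atTop] t := .fun_sum fun k _ => .fun_sum fun l _ => hW.gram k l
  refine (h_sum.const_mul_left (1 / (n : ℝ) ^ 2)).congr_left fun m => ?_
  simp only [Finset.sum_sub_distrib, normTrace_sampleMean_self, Finset.sum_ite_eq,
    Finset.mem_univ, if_true, Finset.sum_const, Finset.card_univ, Fintype.card_fin, nsmul_eq_mul]
  field_simp

theorem IsAsymptoticallyWhite.pooledEstimator_sub_isLittleO (hW : IsAsymptoticallyWhite A t W)
    (hn : 2 ≤ n) : (fun m => pooledEstimator (fun k => A m + W m k) - t m) =o[atTop] t := by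
  have hn' : (n : ℝ) - 1 ≠ 0 := by
    have : (2 : ℝ) ≤ n := by exact_mod_cast hn
    linarith
  have h_diag : (fun m => ∑ k, (normTrace (W m k) (W m k) - t m)) =o[atTop] t :=
    .fun_sum fun k _ => by simpa using hW.gram k k
  refine ((h_diag.sub (hW.normTrace_sampleMean_self_sub_isLittleO.const_mul_left n)).const_mul_left
    (1 / ((n : ℝ) - 1))).congr_left fun m => ?_
  rw [pooledEstimator_const_add _ _ (by omega), Finset.sum_sub_distrib, Finset.sum_const,
    Finset.card_univ, Fintype.card_fin, nsmul_eq_mul]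
  field_simp
  ring

theorem isBigO_oracleDenominator (hn : n ≠ 0) (ht : ∀ᶠ m in atTop, 0 < t m) :
    t =O[atTop] fun m => oracleDenominator n (A m) (t m) := by
  refine IsBigO.of_bound n (ht.mono fun m hm => ?_)
  rw [Real.norm_of_nonneg hm.le, Real.norm_of_nonneg (oracleDenominator_pos (A m) hn hm).le]
  exact le_mul_oracleDenominator (A m) hn

theorem IsAsymptoticallyWhite.hatDenominator_sub_isLittleO (hW : IsAsymptoticallyWhite A t W)
    (hn : n ≠ 0) (ht : ∀ᶠ m in atTop, 0 < t m) :
    (fun m => hatDenominator (fun k => A m + W m k) - oracleDenominator n (A m) (t m)) =o[atTop]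
      fun m => oracleDenominator n (A m) (t m) := by
  have h_ones : (fun m => normTrace (onesMatrix m (p m)) (sampleMean (W m)) ^ 2) =o[atTop] t :=
    ((isLittleO_normTrace_sampleMean hW.ones).pow two_pos).congr' .rfl
      (ht.mono fun m hm => Real.sq_sqrt hm.le)
  have h_noise := (hW.normTrace_sampleMean_self_sub_isLittleO.sub h_ones).trans_isBigO
    (isBigO_oracleDenominator (A := A) hn ht)
  refine (h_noise.add ((isLittleO_normTrace_sampleMean hW.signal).const_mul_left 2)).congr_left
    fun m => ?_
  rw [hatDenominator_const_add _ _ hn, oracleDenominator, normTrace_comm (sampleMean (W m))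
    (onesMatrix m (p m))]
  ring

theorem IsAsymptoticallyWhite.eventually_hatDenominator_ne_zero (hW : IsAsymptoticallyWhite A t W)
    (hn : n ≠ 0) (ht : ∀ᶠ m in atTop, 0 < t m) :
    ∀ᶠ m in atTop, hatDenominator (fun k => A m + W m k) ≠ 0 :=
  eventually_ne_zero_of_sub_isLittleO (hW.hatDenominator_sub_isLittleO hn ht)
    (ht.mono fun m hm => (oracleDenominator_pos (A m) hn hm).ne')

variable {S : (m : ℕ) → Matrix (Fin m) (Fin m) ℝ}

theorem IsAsymptoticallyWhite.tendsto_pooledEstimator_sub_noiseLevel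
    (hW : IsAsymptoticallyWhite A (fun m => noiseLevel (S m)) W) (hn : 2 ≤ n)
    (hS_bdd : (fun m => noiseLevel (S m)) =O[atTop] fun _ => (1 : ℝ)) :
    Tendsto (fun m => pooledEstimator (fun k => A m + W m k) - noiseLevel (S m)) atTop (𝓝 0) :=
  (isLittleO_one_iff ℝ).1 ((hW.pooledEstimator_sub_isLittleO hn).trans_isBigO hS_bdd)

theorem IsAsymptoticallyWhite.tendsto_alphaHat_sub_alphaOracle
    (hW : IsAsymptoticallyWhite A (fun m => noiseLevel (S m)) W) (hn : 2 ≤ n)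
    (hS : ∀ᶠ m in atTop, 0 < noiseLevel (S m)) :
    Tendsto (fun m => alphaHat (fun k => A m + W m k) - alphaOracle n (A m) (S m)) atTop
      (𝓝 0) := by
  have hn0 : n ≠ 0 := by omega
  have hG : ∀ᶠ m in atTop, oracleDenominator n (A m) (noiseLevel (S m)) ≠ 0 :=
    hS.mono fun m hm => (oracleDenominator_pos (A m) hn0 hm).ne'
  have ht := isBigO_oracleDenominator (A := A) hn0 hS
  have h_num := (hW.pooledEstimator_sub_isLittleO hn).trans_isBigO ht
  have h_ratio := tendsto_div_sub_div_zero (hW.hatDenominator_sub_isLittleO hn0 hS)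
    ((h_num.const_mul_left (1 / (n : ℝ))).congr_left fun m => mul_sub _ _ _)
    (ht.const_mul_left (1 / (n : ℝ))) hG
  refine (neg_zero (G := ℝ) ▸ h_ratio.neg).congr' (hG.mono fun m hm => ?_)
  rw [one_div_mul_eq_div _ (noiseLevel (S m)), ← one_sub_alphaOracle _ _ hm, ← one_sub_alphaHat]
  ring

theorem one_sub_alphaOracle_mem_Icc {m p : ℕ} {A : Matrix (Fin m) (Fin p) ℝ}
    {S : Matrix (Fin m) (Fin m) ℝ} (hn : n ≠ 0) (hS : 0 < noiseLevel S) :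
    1 - alphaOracle n A S ∈ Set.Icc 0 1 := by
  have hG := oracleDenominator_pos A hn hS
  rw [one_sub_alphaOracle A S hG.ne']
  exact ⟨by positivity, div_le_one_of_le₀ (le_add_of_nonneg_left (normTrace_self_nonneg _)) hG.le⟩

theorem isBigO_one_of_nonneg_of_le {f : ℕ → ℝ} (h0 : ∀ m, 0 ≤ f m) (h : ∃ B, ∀ m, f m ≤ B) :
    f =O[atTop] fun _ => (1 : ℝ) := by
  obtain ⟨B, hB⟩ := h
  exact IsBigO.of_bound B (.of_forall fun m => by simpa [abs_of_nonneg (h0 m)] using hB m)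

theorem IsAsymptoticallyWhite.tendsto_betaHat_sub_betaOracle
    (hW : IsAsymptoticallyWhite A (fun m => noiseLevel (S m)) W) (hn : 2 ≤ n)
    (hA_bdd : (fun m => normTrace (A m) (A m)) =O[atTop] fun _ => (1 : ℝ))
    (hS : ∀ᶠ m in atTop, 0 < noiseLevel (S m))
    (hS_bdd : (fun m => noiseLevel (S m)) =O[atTop] fun _ => (1 : ℝ)) :
    Tendsto (fun m => betaHat (fun k => A m + W m k) - betaOracle n (A m) (S m)) atTop (𝓝 0) := by
  have hn0 : n ≠ 0 := by omega
  have hα := (isLittleO_one_iff ℝ).2 (hW.tendsto_alphaHat_sub_alphaOracle hn hS)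
  have h_oracle : (fun m => 1 - alphaOracle n (A m) (S m)) =O[atTop] fun _ => (1 : ℝ) := by
    refine IsBigO.of_bound 1 (hS.mono fun m hm => ?_)
    have h := one_sub_alphaOracle_mem_Icc (A := A m) hn0 hm
    simpa [abs_of_nonneg h.1] using h.2
  have h_signal : (fun m => normTrace (A m) (onesMatrix m (p m))) =O[atTop] fun _ => (1 : ℝ) := by
    refine IsBigO.of_pow two_ne_zero ((IsBigO.of_bound 1 ?_).trans (hA_bdd.congr_right ?_))
    · exact Eventually.of_forall fun m => by
        simpa [abs_of_nonneg (normTrace_self_nonneg (A m))] using sq_normTrace_ones_le (A m)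
    · simp
  have h_noise : (fun m => normTrace (onesMatrix m (p m)) (sampleMean (W m))) =o[atTop]
      fun _ => (1 : ℝ) := by
    refine (isLittleO_normTrace_sampleMean hW.ones).trans_isBigO
      (IsBigO.of_pow two_ne_zero (hS_bdd.congr' ?_ (.of_forall fun _ => (one_pow 2).symm)))
    exact hS.mono fun m hm => (Real.sq_sqrt hm.le).symm
  have h_error := (h_oracle.mul_isLittleO h_noise).sub
    ((h_signal.add h_noise.isBigO).mul_isLittleO hα)
  rw [← isLittleO_one_iff ℝ]
  refine (h_error.congr_right fun _ => mul_one 1).congr_left fun m => ?_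
  rw [betaHat, betaOracle, sampleMean_const_add _ _ hn0, normTrace_add_left,
    normTrace_comm (sampleMean (W m))]
  ring

end AsymptoticallyWhite

section NoiseRates

open Asymptotics

variable {Ω : Type*} [MeasurableSpace Ω] {μ : Measure Ω}

theorem ae_isLittleO_of_lpNorm_sq_le {r : ℝ≥0} {Z : ℕ → Ω → ℝ} {g P : ℕ → ℝ} {C : ℝ} (hr : 2 < r)
    (hZ : ∀ m, MemLp (Z m) r μ) (hg : ∀ᶠ m in atTop, g m ≠ 0)
    (hP : (fun m : ℕ => (m : ℝ)) =O[atTop] P)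
    (h : ∀ᶠ m in atTop, lpNorm (Z m) r μ ^ 2 ≤ C * g m ^ 2 / P m) :
    ∀ᵐ ω ∂μ, (fun m => Z m ω) =o[atTop] g := by
  refine ae_isLittleO_of_lpNorm_isBigO (s := 1 / 2) (two_pos.trans hr) ?_ hZ hg
    (IsBigO.of_pow two_ne_zero ?_)
  · have : (2 : ℝ) < r := by exact_mod_cast hr
    linarith
  have h_inv : (fun m => (P m)⁻¹) =O[atTop] fun m : ℕ => (m : ℝ)⁻¹ :=
    hP.inv_rev (by filter_upwards [eventually_gt_atTop 0] with m hm h0; simp_all)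
  have h_bound : (fun m => lpNorm (Z m) r μ ^ 2) =O[atTop] fun m => g m ^ 2 * (P m)⁻¹ := by
    refine IsBigO.of_bound |C| (h.mono fun m hm => ?_)
    rw [Real.norm_of_nonneg (by positivity), Real.norm_eq_abs, ← abs_mul]
    exact hm.trans_eq (by ring) |>.trans (le_abs_self _)
  refine (h_bound.trans ((isBigO_refl _ _).mul h_inv)).congr_right fun m => ?_
  simp only [Pi.pow_apply]
  rw [mul_pow, ← Real.rpow_natCast ((m : ℝ) ^ _), ← Real.rpow_mul m.cast_nonneg,
    ← Real.rpow_neg_one]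
  norm_num

theorem sqrt_mul_transpose_sqrt {α : Type*} [Fintype α] {S : Matrix α α ℝ}
    (hS : S.PosSemidef) :
    open scoped Classical in CFC.sqrt S * (CFC.sqrt S).transpose = S := by
  classical
  have h_symm : (CFC.sqrt S).transpose = CFC.sqrt S := by
    have h := (Matrix.nonneg_iff_posSemidef.1 (CFC.sqrt_nonneg S)).isHermitian
    rwa [Matrix.IsHermitian, Matrix.conjTranspose_eq_transpose_of_trivial] at h
  rw [h_symm, CFC.sqrt_mul_sqrt_self S hS.nonneg]

theorem isWhiteNoise_of_integral_abs_rpow_le {α β κ : Type*} {r : ℝ≥0} {K : ℝ}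
    {E : κ → Ω → Matrix α β ℝ} (hr : r ≠ 0) (hE : ∀ k i j, Measurable fun ω => E k ω i j)
    (hE_indep : iIndepFun (fun (t : κ × α × β) ω => E t.1 ω t.2.1 t.2.2) μ)
    (hE_mean : ∀ k i j, ∫ ω, E k ω i j ∂μ = 0)
    (hE_var : ∀ k i j, variance (fun ω => E k ω i j) μ = 1)
    (hE_moment : ∀ k i j, Integrable (fun ω => |E k ω i j| ^ (r : ℝ)) μ ∧
      ∫ ω, |E k ω i j| ^ (r : ℝ) ∂μ ≤ K) :
    IsWhiteNoise μ r (K ^ (r : ℝ)⁻¹) E where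
  measurable := hE
  iIndepFun := hE_indep
  integral_eq_zero := hE_mean
  integral_sq_eq_one k i j := by
    rw [← variance_of_integral_eq_zero (hE k i j).aemeasurable (hE_mean k i j), hE_var]
  memLp k i j := by
    rw [← integrable_norm_rpow_iff (hE k i j).aestronglyMeasurable (by simpa) (by simp)]
    exact (hE_moment k i j).1
  lpNorm_le k i j := by
    rw [lpNorm_nnreal_eq_integral_norm_rpow hr (hE k i j).aestronglyMeasurable]
    exact Real.rpow_le_rpow (by positivity) (hE_moment k i j).2 (by positivity)

variable [IsProbabilityMeasure μ] {κ : Type*} {p : ℕ → ℕ} {q r : ℝ≥0} {K : ℝ}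
  {S : (m : ℕ) → Matrix (Fin m) (Fin m) ℝ}

theorem ae_normTrace_noise_isLittleO {E : (m : ℕ) → κ → Ω → Matrix (Fin m) (Fin (p m)) ℝ}
    {B : (m : ℕ) → Matrix (Fin m) (Fin (p m)) ℝ} {g : ℕ → ℝ} {c : ℝ} (hr : 2 < r)
    (hp : (fun m : ℕ => (m : ℝ)) =O[atTop] fun m => (p m : ℝ)) (hS : ∀ m, (S m).PosSemidef)
    (hE : ∀ m, IsWhiteNoise μ r K (E m)) (hg : ∀ᶠ m in atTop, g m ≠ 0)
    (hB : ∀ᶠ m in atTop, noiseLevel (S m) * normTrace (B m) (B m) ≤ c * g m ^ 2) (k : κ) :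
    ∀ᵐ ω ∂μ, (fun m => normTrace (B m) (CFC.sqrt (S m) * E m k ω)) =o[atTop] g := by
  refine ae_isLittleO_of_lpNorm_sq_le (C := 2 * taylorConst r * K ^ 2 * c) hr
    (fun m => memLp_normTrace_mul (hE m) (B m) _ k) hg hp (hB.mono fun m hm => ?_)
  have h := lpNorm_normTrace_mul_sq_le (hE m) hr.le (B m) (CFC.sqrt (S m)) k
  rw [sqrt_mul_transpose_sqrt (hS m)] at h
  have hC : 0 ≤ 2 * taylorConst r * K ^ 2 := by
    have := taylorConst_nonneg r
    positivity
  rw [mul_assoc _ c]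
  exact h.trans (div_le_div_of_nonneg_right (mul_le_mul_of_nonneg_left hm hC) (Nat.cast_nonneg _))

theorem ae_normTrace_noise_noise_sub_isLittleO [DecidableEq κ] [Countable κ]
    {E : (m : ℕ) → κ → Ω → Matrix (Fin m) (Fin (p m)) ℝ} (hq : 2 < q)
    (hp : (fun m : ℕ => (m : ℝ)) =O[atTop] fun m => (p m : ℝ)) (hS : ∀ m, (S m).PosSemidef)
    (hS_pos : ∀ᶠ m in atTop, 0 < noiseLevel (S m))
    (hE : ∀ m, IsWhiteNoise μ (2 * q) K (E m)) (k l : κ) :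
    ∀ᵐ ω ∂μ, (fun m => normTrace (CFC.sqrt (S m) * E m k ω) (CFC.sqrt (S m) * E m l ω) -
      if k = l then noiseLevel (S m) else 0) =o[atTop] fun m => noiseLevel (S m) := by
  have hp0 : ∀ᶠ m in atTop, p m ≠ 0 := by
    filter_upwards [hp.eq_zero_imp, eventually_gt_atTop 0] with m h hm h0
    simp_all
  refine ae_isLittleO_of_lpNorm_sq_le
    (C := 2 * taylorConst q * (4 * taylorConst (2 * q) * K ^ 2) ^ 2) hq
    (fun m => (memLp_normTrace_mul_mul (hE m) _ k l).sub (memLp_const _))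
    (hS_pos.mono fun m hm => hm.ne') hp (hp0.mono fun m hm => ?_)
  have h := lpNorm_normTrace_mul_mul_sub_sq_le (hE m) hq.le hm (CFC.sqrt (S m)) k l
  rwa [sqrt_mul_transpose_sqrt (hS m)] at h

theorem ae_isAsymptoticallyWhite {n : ℕ} {A : (m : ℕ) → Matrix (Fin m) (Fin (p m)) ℝ}
    {E : (m : ℕ) → Fin n → Ω → Matrix (Fin m) (Fin (p m)) ℝ} (hn : n ≠ 0) (hq : 2 < q)
    (hp : (fun m : ℕ => (m : ℝ)) =O[atTop] fun m => (p m : ℝ)) (hS : ∀ m, (S m).PosSemidef)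
    (hS_pos : ∀ᶠ m in atTop, 0 < noiseLevel (S m))
    (hE : ∀ m, IsWhiteNoise μ (2 * q) K (E m)) :
    ∀ᵐ ω ∂μ, IsAsymptoticallyWhite A (fun m => noiseLevel (S m))
      fun m k => CFC.sqrt (S m) * E m k ω := by
  have hq2 : 2 < 2 * q := hq.trans_le (le_mul_of_one_le_left q.2 one_le_two)
  have h_gram := ae_normTrace_noise_noise_sub_isLittleO hq hp hS hS_pos hE
  have h_ones := ae_normTrace_noise_isLittleO (B := fun m => onesMatrix m (p m))
    (g := fun m => √(noiseLevel (S m))) (c := 1) hq2 hp hS hE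
    (hS_pos.mono fun m hm => (Real.sqrt_pos.2 hm).ne') (hS_pos.mono fun m hm => by
      rw [Real.sq_sqrt hm.le, one_mul]
      exact mul_le_of_le_one_right hm.le normTrace_ones_self_le_one)
  have h_signal := ae_normTrace_noise_isLittleO (B := fun m => centered (A m))
    (g := fun m => oracleDenominator n (A m) (noiseLevel (S m))) hq2 hp hS hE
    (hS_pos.mono fun m hm => (oracleDenominator_pos (A m) hn hm).ne')
    (hS_pos.mono fun m hm => mul_normTrace_centered_le (A m) hn hm.le)
  filter_upwards [ae_all_iff.2 fun k => ae_all_iff.2 fun l => h_gram k l,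
    ae_all_iff.2 h_ones, ae_all_iff.2 h_signal] with ω hω_gram hω_ones hω_signal
  exact ⟨hω_gram, hω_ones, hω_signal⟩

end NoiseRates

end Shrinkage

theorem lemma2_general {Ω : Type*} [MeasurableSpace Ω] (μ : Measure Ω) [IsProbabilityMeasure μ]
    (n : ℕ) (hn : 2 ≤ n) (p : ℕ → ℕ)
    (hp : (fun m : ℕ => (m : ℝ)) =O[atTop] fun m => (p m : ℝ))
    (A : (m : ℕ) → Matrix (Fin m) (Fin (p m)) ℝ)
    (hA_bdd : ∃ B : ℝ, ∀ m : ℕ,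
      1 / ((m : ℝ) * (p m : ℝ)) * (A m * (A m).transpose).trace ≤ B)
    (S : (m : ℕ) → Matrix (Fin m) (Fin m) ℝ) (hS : ∀ m, (S m).PosSemidef)
    (hS_pos : ∀ᶠ m : ℕ in atTop, 0 < 1 / (m : ℝ) * (S m).trace)
    (hS_bdd : ∃ B : ℝ, ∀ m : ℕ, 1 / (m : ℝ) * (S m).trace ≤ B)
    (E : (m : ℕ) → Fin n → Ω → Matrix (Fin m) (Fin (p m)) ℝ)
    (hE_meas : ∀ m k i j, Measurable fun ω => E m k ω i j)
    (hE_indep : ∀ m, iIndepFun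
      (fun (t : Fin n × Fin m × Fin (p m)) (ω : Ω) => E m t.1 ω t.2.1 t.2.2) μ)
    (hE_mean : ∀ m k i j, ∫ ω, E m k ω i j ∂μ = 0)
    (hE_var : ∀ m k i j, variance (fun ω => E m k ω i j) μ = 1)
    (hE_moment : ∃ ε : ℝ, 0 < ε ∧ ∃ K : ℝ, ∀ m k i j,
      Integrable (fun ω => |E m k ω i j| ^ (4 + ε)) μ ∧
        ∫ ω, |E m k ω i j| ^ (4 + ε) ∂μ ≤ K) :
    (∀ᵐ ω ∂μ, Tendsto
      (fun m : ℕ => |Shrinkage.pooledEstimator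
          (fun k => Shrinkage.observation (A m) (S m) (E m k ω)) -
        1 / (m : ℝ) * (S m).trace|) atTop (𝓝 0)) ∧
    (∀ᵐ ω ∂μ, ∀ᶠ m : ℕ in atTop, Shrinkage.hatDenominator
      (fun k => Shrinkage.observation (A m) (S m) (E m k ω)) ≠ 0) ∧
    (∀ᵐ ω ∂μ, Tendsto
      (fun m : ℕ => |Shrinkage.alphaHat
          (fun k => Shrinkage.observation (A m) (S m) (E m k ω)) -
        Shrinkage.alphaOracle n (A m) (S m)|) atTop (𝓝 0)) ∧
    (∀ᵐ ω ∂μ, Tendsto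
      (fun m : ℕ => |Shrinkage.betaHat
          (fun k => Shrinkage.observation (A m) (S m) (E m k ω)) -
        Shrinkage.betaOracle n (A m) (S m)|) atTop (𝓝 0)) := by
  obtain ⟨ε, hε, K, hK⟩ := hE_moment
  have hn0 : n ≠ 0 := by omega
  let q : NNReal := ⟨(4 + ε) / 2, by positivity⟩
  have hq : 2 < q := by
    rw [← NNReal.coe_lt_coe]
    change (2 : ℝ) < (4 + ε) / 2
    linarith
  have h_exponent : ((2 * q : NNReal) : ℝ) = 4 + ε := mul_div_cancel₀ (4 + ε) two_ne_zero
  have hE (m : ℕ) : Shrinkage.IsWhiteNoise μ (2 * q) _ (E m) :=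
    Shrinkage.isWhiteNoise_of_integral_abs_rpow_le (mul_pos two_pos (two_pos.trans hq)).ne'
      (hE_meas m) (hE_indep m) (hE_mean m) (hE_var m) (h_exponent ▸ hK m)
  have hA_bigO := Shrinkage.isBigO_one_of_nonneg_of_le
    (fun m => Shrinkage.normTrace_self_nonneg (A m)) hA_bdd
  have hS_bigO := Shrinkage.isBigO_one_of_nonneg_of_le
    (fun m => Shrinkage.noiseLevel_nonneg (hS m)) hS_bdd
  have h_white := Shrinkage.ae_isAsymptoticallyWhite (A := A) hn0 hq hp hS hS_pos hE
  refine ⟨?_, ?_, ?_, ?_⟩ <;> filter_upwards [h_white] with ω hω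
  · exact (tendsto_zero_iff_abs_tendsto_zero _).1
      (hω.tendsto_pooledEstimator_sub_noiseLevel hn hS_bigO)
  · exact hω.eventually_hatDenominator_ne_zero hn0 hS_pos
  · exact (tendsto_zero_iff_abs_tendsto_zero _).1 (hω.tendsto_alphaHat_sub_alphaOracle hn hS_pos)
  · exact (tendsto_zero_iff_abs_tendsto_zero _).1
      (hω.tendsto_betaHat_sub_betaOracle hn hA_bigO hS_pos hS_bigO)

theorem lemma2 {Ω : Type*} [MeasurableSpace Ω] (μ : Measure Ω) [IsProbabilityMeasure μ]
    (n : ℕ) (hn : 2 ≤ n)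
    (p : ℕ → ℕ) (c : ℝ) (hc : 0 < c)
    (hp : Tendsto p atTop atTop)
    (hmp : Tendsto (fun m : ℕ => (m : ℝ) / (p m : ℝ)) atTop (𝓝 c))
    (A : (m : ℕ) → Matrix (Fin m) (Fin (p m)) ℝ)
    (hA_nonneg : ∀ m i j, 0 ≤ A m i j)
    (hA_bdd : ∃ B : ℝ, ∀ m : ℕ,
      1 / ((m : ℝ) * (p m : ℝ)) * (A m * (A m).transpose).trace ≤ B)
    (S : (m : ℕ) → Matrix (Fin m) (Fin m) ℝ)
    (hS_pos : ∀ m, (S m).PosDef)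
    (hS_bdd : ∃ B : ℝ, ∀ m : ℕ, 1 / (m : ℝ) * (S m).trace ≤ B)
    (E : (m : ℕ) → Fin n → Ω → Matrix (Fin m) (Fin (p m)) ℝ)
    (hE_meas : ∀ m k i j, Measurable fun ω => E m k ω i j)
    (hE_indep : ∀ m, iIndepFun
      (fun (t : Fin n × Fin m × Fin (p m)) (ω : Ω) => E m t.1 ω t.2.1 t.2.2) μ)
    (hE_ident : ∀ m k i j i' j',
      IdentDistrib (fun ω => E m k ω i j) (fun ω => E m k ω i' j') μ μ)
    (hE_mean : ∀ m k i j, ∫ ω, E m k ω i j ∂μ = 0)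
    (hE_var : ∀ m k i j, variance (fun ω => E m k ω i j) μ = 1)
    (hE_moment : ∃ ε : ℝ, 0 < ε ∧ ∃ K : ℝ, ∀ m k i j,
      Integrable (fun ω => |E m k ω i j| ^ (4 + ε)) μ ∧
        ∫ ω, |E m k ω i j| ^ (4 + ε) ∂μ ≤ K) :
    (∀ᵐ ω ∂μ, Tendsto
      (fun m : ℕ => |Shrinkage.pooledEstimator
          (fun k => Shrinkage.observation (A m) (S m) (E m k ω)) -
        1 / (m : ℝ) * (S m).trace|) atTop (𝓝 0)) ∧
    (∀ᵐ ω ∂μ, ∀ᶠ m : ℕ in atTop, Shrinkage.hatDenominator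
      (fun k => Shrinkage.observation (A m) (S m) (E m k ω)) ≠ 0) ∧
    (∀ᵐ ω ∂μ, Tendsto
      (fun m : ℕ => |Shrinkage.alphaHat
          (fun k => Shrinkage.observation (A m) (S m) (E m k ω)) -
        Shrinkage.alphaOracle n (A m) (S m)|) atTop (𝓝 0)) ∧
    (∀ᵐ ω ∂μ, Tendsto
      (fun m : ℕ => |Shrinkage.betaHat
          (fun k => Shrinkage.observation (A m) (S m) (E m k ω)) -
        Shrinkage.betaOracle n (A m) (S m)|) atTop (𝓝 0)) := by
  exact lemma2_general μ n hn p (Shrinkage.isBigO_natCast_of_tendsto_div hp hmp) A hA_bdd S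
    (fun m => (hS_pos m).posSemidef)
    ((eventually_ne_atTop 0).mono fun m hm => Shrinkage.noiseLevel_pos hm (hS_pos m)) hS_bdd E
    hE_meas hE_indep hE_mean hE_var hE_moment
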